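/- For $\delta\in\mathbb R$ let $y=y_\delta:\mathbb R\to\mathbb R$ be the unique solution of the Duffing problem $\ddot y+y+y^3=0$, $y(0)=\delta$, $\dot y(0)=0$, and for $\delta>0$, $\gamma\in\mathbb R$ consider the Hill equation $$\ddot\xi(t)+\big(\gamma+y_\delta(t)^2\big)\,\xi(t)=0. \qquad (\ast)$$ The trivial solution of $(\ast)$ is called stable if all solutions of $(\ast)$ are bounded on $\mathbb R$, and unstable otherwise. Let $I\subset(0,\infty)\times\mathbb R$ be the set of those $(\delta,\gamma)$ for which it is unstable. The resonance tongue $U_1$ emanating from $(\delta,\gamma)=(0,1)$ is the connected component of the interior of $I$ whose closure contains the point $(0,1)$ (more precisely, the union of all such components). **Theorem 3.2.** One has $$U_1=\Big\{(\delta,\gamma)\in\mathbb R^2:\ \delta>0,\ \gamma>0,\ 1<\gamma<1+\frac{\delta^2}{2}\Big\},$$ so the boundary of $U_1$ in the half-plane $\delta>0$ consists of the line $\gamma=1$ and the parabola $\gamma=1+\delta^2/2$. Moreover, for every $\delta>0$ the function $y_\delta^2$ has a least positive period $\tau$, and * for $\gamma=1$, $\xi(t)=y_\delta(t)$ is a nontrivial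 solution of $(\ast)$ with $\xi(t+\tau)=-\xi(t)$ for all $t$; * for $\gamma=1+\delta^2/2$, $\xi(t)=\operatorname{sn}\big(t\sqrt{1+\delta^2},\,k\big)$ with modulus $k=\delta/\sqrt{2(1+\delta^2)}$ is a nontrivial solution of $(\ast)$ with $\xi(t+\tau)=-\xi(t)$ for all $t$. Here $\operatorname{sn}(u,k)=\sin\varphi$, where $\varphi$ is determined by $u=\int_0^\varphi (1-k^2\sin^2\theta)^{-1/2}\,d\theta$. -/

import Mathlib

open Set Topology

noncomputable section

namespace DuffingHill

/-! ### Jacobi elliptic functions (real argument, modulus `k`) -/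

/-- The incomplete elliptic integral of the first kind,
`F(φ, k) = ∫₀^φ dθ / √(1 - k² sin² θ)`. -/
def ellipticF (k φ : ℝ) : ℝ :=
  ∫ θ in (0 : ℝ)..φ, 1 / Real.sqrt (1 - k ^ 2 * Real.sin θ ^ 2)

/-- The Jacobi amplitude: `am(u, k)` is the `φ` with `F(φ, k) = u`.
For `k² < 1` the function `F(·, k)` is a bijection of `ℝ`, see `ellipticF_bijective`. -/
def jacobiAm (u k : ℝ) : ℝ := Function.invFun (ellipticF k) u

/-- `sn(u, k) = sin (am(u, k))`. -/
def jacobiSn (u k : ℝ) : ℝ := Real.sin (jacobiAm u k)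

/-- `cn(u, k) = cos (am(u, k))`. -/
def jacobiCn (u k : ℝ) : ℝ := Real.cos (jacobiAm u k)

/-- `dn(u, k) = √(1 - k² sn(u, k)²)`. -/
def jacobiDn (u k : ℝ) : ℝ := Real.sqrt (1 - k ^ 2 * jacobiSn u k ^ 2)

lemma one_sub_pos {k : ℝ} (hk : k ^ 2 < 1) (φ : ℝ) : 0 < 1 - k ^ 2 * Real.sin φ ^ 2 := by
  nlinarith [Real.sin_sq_le_one φ, sq_nonneg k, sq_nonneg (Real.sin φ)]

lemma hasDerivAt_ellipticF {k : ℝ} (hk : k ^ 2 < 1) (φ : ℝ) :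
    HasDerivAt (ellipticF k) (1 / Real.sqrt (1 - k ^ 2 * Real.sin φ ^ 2)) φ := by
  have hc : Continuous fun θ : ℝ => 1 / Real.sqrt (1 - k ^ 2 * Real.sin θ ^ 2) := by
    refine continuous_const.div (by fun_prop) fun θ => ?_
    exact (Real.sqrt_pos.2 (one_sub_pos hk θ)).ne'
  exact (hc.integral_hasStrictDerivAt 0 φ).hasDerivAt

lemma strictMono_ellipticF {k : ℝ} (hk : k ^ 2 < 1) : StrictMono (ellipticF k) := by
  refine strictMono_of_deriv_pos fun φ => ?_
  rw [(hasDerivAt_ellipticF hk φ).deriv]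
  have := Real.sqrt_pos.2 (one_sub_pos hk φ)
  positivity

lemma surjective_ellipticF {k : ℝ} (hk : k ^ 2 < 1) : Function.Surjective (ellipticF k) := by
  have hcont : Continuous (ellipticF k) :=
    continuous_iff_continuousAt.2 fun φ => (hasDerivAt_ellipticF hk φ).continuousAt
  have hmono : Monotone fun φ => ellipticF k φ - φ := by
    refine monotone_of_deriv_nonneg
      (fun φ => ((hasDerivAt_ellipticF hk φ).sub (hasDerivAt_id φ)).differentiableAt) fun φ => ?_
    have h := ((hasDerivAt_ellipticF hk φ).sub (hasDerivAt_id φ)).deriv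
    have h' : deriv (fun φ => ellipticF k φ - φ) φ
        = 1 / Real.sqrt (1 - k ^ 2 * Real.sin φ ^ 2) - 1 := h
    rw [h']
    have hp := Real.sqrt_pos.2 (one_sub_pos hk φ)
    have hle : Real.sqrt (1 - k ^ 2 * Real.sin φ ^ 2) ≤ 1 := by
      refine Real.sqrt_le_iff.2 ⟨zero_le_one, ?_⟩
      nlinarith [mul_nonneg (sq_nonneg k) (sq_nonneg (Real.sin φ))]
    have := (one_le_div hp).2 hle
    linarith
  have h0 : ellipticF k 0 = 0 := by simp [ellipticF]
  refine hcont.surjective ?_ ?_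
  · refine Filter.tendsto_atTop_mono' _ ?_ Filter.tendsto_id
    filter_upwards [Filter.eventually_ge_atTop 0] with φ hφ
    have := hmono hφ
    simp only [h0, id] at this ⊢
    linarith
  · refine Filter.tendsto_atBot_mono' _ ?_ Filter.tendsto_id
    filter_upwards [Filter.eventually_le_atBot 0] with φ hφ
    have := hmono hφ
    simp only [h0, id] at this ⊢
    linarith

lemma ellipticF_bijective {k : ℝ} (hk : k ^ 2 < 1) : Function.Bijective (ellipticF k) :=
  ⟨(strictMono_ellipticF hk).injective, surjective_ellipticF hk⟩

lemma ellipticF_jacobiAm {k : ℝ} (hk : k ^ 2 < 1) (u : ℝ) : ellipticF k (jacobiAm u k) = u :=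
  Function.rightInverse_invFun (surjective_ellipticF hk) u

lemma hasDerivAt_jacobiAm {k : ℝ} (hk : k ^ 2 < 1) (u : ℝ) :
    HasDerivAt (fun u => jacobiAm u k) (jacobiDn u k) u := by
  have heq : (fun u => jacobiAm u k) =
      ((strictMono_ellipticF hk).orderIsoOfSurjective _ (surjective_ellipticF hk)).symm := by
    funext u
    apply (strictMono_ellipticF hk).injective
    rw [ellipticF_jacobiAm hk]
    exact (((strictMono_ellipticF hk).orderIsoOfSurjective _
      (surjective_ellipticF hk)).apply_symm_apply u).symm
  have hc : Continuous fun u => jacobiAm u k := by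
    rw [heq]; exact OrderIso.continuous _
  have hp := Real.sqrt_pos.2 (one_sub_pos hk (jacobiAm u k))
  have h := HasDerivAt.of_local_left_inverse (hc.continuousAt (x := u))
    (hasDerivAt_ellipticF hk (jacobiAm u k)) (by positivity)
    (Filter.Eventually.of_forall (ellipticF_jacobiAm hk))
  simpa [jacobiDn, jacobiSn] using h

lemma hasDerivAt_jacobiSn {k : ℝ} (hk : k ^ 2 < 1) (u : ℝ) :
    HasDerivAt (fun u => jacobiSn u k) (jacobiCn u k * jacobiDn u k) u :=
  (hasDerivAt_jacobiAm hk u).sin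

lemma hasDerivAt_jacobiCn {k : ℝ} (hk : k ^ 2 < 1) (u : ℝ) :
    HasDerivAt (fun u => jacobiCn u k) (-jacobiSn u k * jacobiDn u k) u :=
  (hasDerivAt_jacobiAm hk u).cos

lemma sq_jacobiDn {k : ℝ} (hk : k ^ 2 < 1) (u : ℝ) :
    jacobiDn u k ^ 2 = 1 - k ^ 2 * jacobiSn u k ^ 2 :=
  Real.sq_sqrt (one_sub_pos hk _).le

lemma hasDerivAt_jacobiDn {k : ℝ} (hk : k ^ 2 < 1) (u : ℝ) :
    HasDerivAt (fun u => jacobiDn u k) (-k ^ 2 * jacobiCn u k * jacobiSn u k) u := by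
  have hp := one_sub_pos hk (jacobiAm u k)
  have h := ((((hasDerivAt_jacobiSn hk u).pow 2).const_mul (k ^ 2)).const_sub 1).sqrt hp.ne'
  refine h.congr_deriv ?_
  have hd : Real.sqrt (1 - k ^ 2 * jacobiSn u k ^ 2) = jacobiDn u k := rfl
  have hd0 : jacobiDn u k ≠ 0 := (Real.sqrt_pos.2 hp).ne'
  simp only [Pi.pow_apply]
  rw [hd]
  field_simp
  ring

/-! ### The Duffing equation -/

/-- `y` is a (global, classical) solution of `y'' + y + y³ = 0`, `y(0) = δ`, `y'(0) = 0`. -/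
structure IsDuffingSolution (δ : ℝ) (y : ℝ → ℝ) : Prop where
  differentiable : Differentiable ℝ y
  eqn : ∀ t, HasDerivAt (deriv y) (-(y t + y t ^ 3)) t
  init : y 0 = δ
  init_deriv : deriv y 0 = 0

/-- The modulus `k = δ / √(2 (1 + δ²))`. -/
def modulus (δ : ℝ) : ℝ := δ / Real.sqrt (2 * (1 + δ ^ 2))

lemma sq_modulus (δ : ℝ) : modulus δ ^ 2 = δ ^ 2 / (2 * (1 + δ ^ 2)) := by
  rw [modulus, div_pow, Real.sq_sqrt (by positivity)]

lemma sq_modulus_lt_one (δ : ℝ) : modulus δ ^ 2 < 1 := by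
  rw [sq_modulus, div_lt_one (by positivity)]
  nlinarith [sq_nonneg δ]

lemma isDuffingSolution_cn (δ : ℝ) :
    IsDuffingSolution δ fun t => δ * jacobiCn (t * Real.sqrt (1 + δ ^ 2)) (modulus δ) := by
  have hk := sq_modulus_lt_one δ
  set k := modulus δ with hkdef
  set r := Real.sqrt (1 + δ ^ 2) with hr
  have hr2 : r ^ 2 = 1 + δ ^ 2 := Real.sq_sqrt (by positivity)
  have hlin : ∀ t : ℝ, HasDerivAt (fun t : ℝ => t * r) r t := fun t => by
    simpa using (hasDerivAt_id t).mul_const r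
  have hcn : ∀ t : ℝ, HasDerivAt (fun t => δ * jacobiCn (t * r) k)
      (δ * ((-jacobiSn (t * r) k * jacobiDn (t * r) k) * r)) t := fun t =>
    (HasDerivAt.comp (h₂ := fun u => jacobiCn u k) (h := fun t : ℝ => t * r) t
      (hasDerivAt_jacobiCn hk (t * r)) (hlin t)).const_mul δ
  have hsn : ∀ t : ℝ, HasDerivAt (fun t => jacobiSn (t * r) k)
      ((jacobiCn (t * r) k * jacobiDn (t * r) k) * r) t := fun t =>
    HasDerivAt.comp (h₂ := fun u => jacobiSn u k) (h := fun t : ℝ => t * r) t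
      (hasDerivAt_jacobiSn hk (t * r)) (hlin t)
  have hdn : ∀ t : ℝ, HasDerivAt (fun t => jacobiDn (t * r) k)
      ((-k ^ 2 * jacobiCn (t * r) k * jacobiSn (t * r) k) * r) t := fun t =>
    HasDerivAt.comp (h₂ := fun u => jacobiDn u k) (h := fun t : ℝ => t * r) t
      (hasDerivAt_jacobiDn hk (t * r)) (hlin t)
  have hderiv : deriv (fun t => δ * jacobiCn (t * r) k) =
      fun t => δ * ((-jacobiSn (t * r) k * jacobiDn (t * r) k) * r) :=
    funext fun t => (hcn t).deriv
  have h0 : jacobiAm 0 k = 0 := by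
    apply (strictMono_ellipticF hk).injective
    rw [ellipticF_jacobiAm hk]
    simp [ellipticF]
  refine ⟨fun t => (hcn t).differentiableAt, fun t => ?_, ?_, ?_⟩
  · rw [hderiv]
    refine ((((hsn t).neg.mul (hdn t)).mul_const r).const_mul δ).congr_deriv ?_
    have hd2 := sq_jacobiDn hk (t * r)
    have hcs : jacobiSn (t * r) k ^ 2 = 1 - jacobiCn (t * r) k ^ 2 := by
      rw [eq_sub_iff_add_eq]; exact Real.sin_sq_add_cos_sq _
    have hkr : k ^ 2 * r ^ 2 = δ ^ 2 / 2 := by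
      rw [hkdef, sq_modulus, hr2]; field_simp
    simp only [Pi.neg_apply]
    set c := jacobiCn (t * r) k
    set s := jacobiSn (t * r) k
    set d := jacobiDn (t * r) k
    linear_combination (-δ * c * r ^ 2) * hd2 + (2 * δ * c * k ^ 2 * r ^ 2) * hcs
      
      + (2 * δ * c * (1 - c ^ 2)) * hkr - δ * c * hr2
  · simp [jacobiCn, h0]
  · rw [hderiv]; simp [jacobiSn, h0]

lemma IsDuffingSolution.sq_le {δ : ℝ} {y : ℝ → ℝ} (h : IsDuffingSolution δ y) (t : ℝ) :
    y t ^ 2 ≤ δ ^ 2 + δ ^ 4 / 2 := by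
  have hE : ∀ s, HasDerivAt (fun s => deriv y s ^ 2 + y s ^ 2 + y s ^ 4 / 2) 0 s := fun s => by
    have h1 := (h.differentiable s).hasDerivAt
    refine ((((h.eqn s).pow 2).add (h1.pow 2)).add ((h1.pow 4).div_const 2)).congr_deriv ?_
    norm_num
    ring
  have hc := is_const_of_deriv_eq_zero (fun s => (hE s).differentiableAt)
    (fun s => (hE s).deriv) t 0
  simp only [h.init, h.init_deriv] at hc
  nlinarith [sq_nonneg (deriv y t), sq_nonneg (y t ^ 2)]

lemma IsDuffingSolution.unique {δ : ℝ} {y z : ℝ → ℝ} (hy : IsDuffingSolution δ y)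
    (hz : IsDuffingSolution δ z) : y = z := by
  set B := δ ^ 2 + δ ^ 4 / 2 with hB
  set q : ℝ → ℝ := fun t => 1 + y t ^ 2 + y t * z t + z t ^ 2 with hq
  have hqB : ∀ t, |q t| ≤ 1 + 3 * B := fun t => by
    have h1 := hy.sq_le t
    have h2 := hz.sq_le t
    rw [abs_le]
    constructor <;> simp only [hq] <;>
      nlinarith [sq_nonneg (y t + z t), sq_nonneg (y t - z t), sq_nonneg (y t), sq_nonneg (z t)]
  have hB0 : 0 ≤ B := by positivity
  let v : ℝ → ℝ × ℝ → ℝ × ℝ := fun t x => (x.2, -(q t * x.1))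
  have hv : ∀ t, LipschitzOnWith (Real.toNNReal (1 + 3 * B)) (v t) univ := fun t => by
    refine LipschitzOnWith.of_dist_le_mul fun a _ b _ => ?_
    rw [Real.coe_toNNReal _ (by positivity), Prod.dist_eq, Prod.dist_eq]
    have hm1 := le_max_left (dist a.1 b.1) (dist a.2 b.2)
    have hm2 := le_max_right (dist a.1 b.1) (dist a.2 b.2)
    have hd : dist (-(q t * a.1)) (-(q t * b.1)) = |q t| * dist a.1 b.1 := by
      rw [Real.dist_eq, Real.dist_eq, ← abs_mul, abs_sub_comm]
      congr 1
      ring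
    refine max_le ?_ ?_
    · change dist a.2 b.2 ≤ _
      nlinarith [dist_nonneg (x := a.2) (y := b.2)]
    · change dist (-(q t * a.1)) (-(q t * b.1)) ≤ _
      rw [hd]
      exact mul_le_mul (hqB t) hm1 dist_nonneg (by positivity)
  have hf : ∀ t, HasDerivAt (fun t => (y t - z t, deriv y t - deriv z t))
      (v t (y t - z t, deriv y t - deriv z t)) t := fun t => by
    have h1 := (hy.differentiable t).hasDerivAt.sub (hz.differentiable t).hasDerivAt
    have h2 := (hy.eqn t).sub (hz.eqn t)
    refine (h1.prodMk h2).congr_deriv ?_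
    simp only [v, hq, Prod.mk.injEq, true_and]
    ring
  have hg : ∀ t, HasDerivAt (fun _ : ℝ => ((0 : ℝ), (0 : ℝ))) (v t (0, 0)) t := fun t => by
    exact (hasDerivAt_const t ((0 : ℝ), (0 : ℝ))).congr_deriv (by simp [v]; rfl)
  have h := ODE_solution_unique_univ (t₀ := 0) hv (fun t => ⟨hf t, mem_univ _⟩)
    (fun t => ⟨hg t, mem_univ _⟩)
    (by simp [hy.init, hz.init, hy.init_deriv, hz.init_deriv])
  funext t
  have := congrArg Prod.fst (congrFun h t)
  exact sub_eq_zero.1 this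

theorem existsUnique_isDuffingSolution (δ : ℝ) : ∃! y, IsDuffingSolution δ y :=
  ⟨_, isDuffingSolution_cn δ, fun _ hy => hy.unique (isDuffingSolution_cn δ)⟩

/-- The unique solution `y` of `y'' + y + y³ = 0`, `y(0) = δ`, `y'(0) = 0`. -/
def duffing (δ : ℝ) : ℝ → ℝ := (existsUnique_isDuffingSolution δ).choose

lemma isDuffingSolution_duffing (δ : ℝ) : IsDuffingSolution δ (duffing δ) :=
  (existsUnique_isDuffingSolution δ).choose_spec.1

/-! ### The Hill equation, stability, resonance tongues -/

/-- `ξ` is a (global, classical) solution of the Hill equation `ξ'' + p(t) ξ = 0`. -/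
structure IsHillSolution (p ξ : ℝ → ℝ) : Prop where
  differentiable : Differentiable ℝ ξ
  eqn : ∀ t, HasDerivAt (deriv ξ) (-(p t * ξ t)) t

/-- The trivial solution of `ξ'' + p(t) ξ = 0` is stable: all solutions are bounded on `ℝ`. -/
def HillStable (p : ℝ → ℝ) : Prop :=
  ∀ ξ, IsHillSolution p ξ → ∃ C : ℝ, ∀ t, |ξ t| ≤ C

/-- The coefficient `γ + y(t)²`, where `y` is the Duffing solution with `y(0) = δ`, `y'(0) = 0`. -/
def coeff (δ γ : ℝ) (t : ℝ) : ℝ := γ + duffing δ t ^ 2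

/-- The parameters `(δ, γ)` with `δ > 0` for which the trivial solution of
`ξ'' + (γ + y²) ξ = 0` is unstable. -/
def unstableSet : Set (ℝ × ℝ) := {x | 0 < x.1 ∧ ¬ HillStable (coeff x.1 x.2)}

/-- The resonance tongue `U_ℓ` emanating from `(0, ℓ²)`: the connected component (the union of
all of them, should there be several) of the interior of the set of unstable parameters whose
closure contains the point `(0, ℓ²)`. -/
def resonanceTongue (ℓ : ℕ) : Set (ℝ × ℝ) :=
  {x | x ∈ interior unstableSet ∧
    ((0 : ℝ), (ℓ : ℝ) ^ 2) ∈ closure (connectedComponentIn (interior unstableSet) x)}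

end DuffingHill

end

/-! Write `y` for the Duffing solution and `q = γ + y²`. The function `P = y² + 2(1 - γ)` satisfies
`P''' + 4qP' + 2q'P = 0`, the equation obeyed by products of two Hill solutions. Hence the quadratic
form `Q(ξ) = P ξ'² - P' ξ ξ' + (P''/2 + qP) ξ²` is constant along solutions (`hillForm_eq`), and
conservation of energy makes its determinant the constant `W = 4(1 - γ)(1 + δ²/2 - γ)(γ + δ²/2)`
(`hillP_mul_hillR`).

If `W > 0`, the form is definite and every solution is bounded (`hillStable_of_pos`). This covers `0
≤ γ < 1` and `γ > 1 + δ²/2`.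

Between the two curves `W < 0`. Let `h` be the first positive zero of `y`, and `c`, `s` the
solutions with Cauchy data `(1, 0)` and `(0, 1)` at `0`. As `q` is symmetric about `0` and `h`, half
the trace of the monodromy over `2h` is `α = c(2h)`, with `α² = 1 + 4 c(h) s'(h) c'(h) s(h)`. At `0`
and at `h` the form is diagonal, so constancy of its polarization on `(c, s)` determines the sign of
this product once `c(h)` and `s(h)` are nonzero; then `|α| > 1` and `c` is unbounded
(`not_hillStable`).

In the half-plane `γ ≥ 0` the interior of the unstable set is thus exactly the region between the
curves. Other components, if any, stay in `γ < 0`, away from `(0, 1)` (`resonanceTongue_one`). -/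

noncomputable section

namespace DuffingHill

/-! ### Linear differential equations with bounded coefficients -/

section Linear

variable {E : Type*} [NormedAddCommGroup E] [NormedSpace ℝ E]

/-- The iterated integrals `u₀ = x₀`, `uₙ₊₁(t) = ∫₀ᵗ A uₙ` of the Peano–Baker series. -/
def peanoBaker (A : ℝ → E →L[ℝ] E) (x₀ : E) : ℕ → ℝ → E
  | 0 => fun _ => x₀
  | n + 1 => fun t => ∫ s in (0 : ℝ)..t, A s (peanoBaker A x₀ n s)

lemma continuous_peanoBaker {A : ℝ → E →L[ℝ] E} (hA : Continuous A) (x₀ : E) (n : ℕ) :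
    Continuous (peanoBaker A x₀ n) := by
  induction n with
  | zero => exact continuous_const
  | succ n ih =>
    exact intervalIntegral.continuous_primitive
      (fun a b => (hA.clm_apply ih).intervalIntegrable a b) 0

lemma norm_peanoBaker_le {A : ℝ → E →L[ℝ] E} {K : ℝ}
    (hK : ∀ t, ‖A t‖ ≤ K) (x₀ : E) (n : ℕ) (t : ℝ) :
    ‖peanoBaker A x₀ n t‖ ≤ (K * |t|) ^ n / n.factorial * ‖x₀‖ := by
  have hK0 : 0 ≤ K := (norm_nonneg _).trans (hK 0)
  induction n generalizing t with
  | zero => simp [peanoBaker]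
  | succ n ih =>
    -- The form `|s - 0| ^ n` matches `integral_pow_abs_sub_uIoc`, whose factor `1 / (n + 1)` turns
    -- `n!` into `(n + 1)!`.
    have hb : ∀ s, ‖A s (peanoBaker A x₀ n s)‖ ≤
        K ^ (n + 1) / n.factorial * ‖x₀‖ * |s - 0| ^ n := fun s => by
      calc ‖A s (peanoBaker A x₀ n s)‖ ≤ ‖A s‖ * ‖peanoBaker A x₀ n s‖ := (A s).le_opNorm _
        _ ≤ K * ((K * |s|) ^ n / n.factorial * ‖x₀‖) :=
          mul_le_mul (hK s) (ih s) (norm_nonneg _) hK0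
        _ = _ := by rw [sub_zero]; ring
    change ‖∫ s in (0 : ℝ)..t, A s (peanoBaker A x₀ n s)‖ ≤ _
    rw [intervalIntegral.norm_intervalIntegral_eq]
    calc ‖∫ s in uIoc 0 t, A s (peanoBaker A x₀ n s)‖
        ≤ ∫ s in uIoc 0 t, K ^ (n + 1) / n.factorial * ‖x₀‖ * |s - 0| ^ n := by
          refine MeasureTheory.norm_integral_le_of_norm_le ?_ (Filter.Eventually.of_forall hb)
          exact Continuous.integrableOn_uIoc
            (continuous_const.mul ((continuous_id.sub continuous_const).abs.pow n))
      _ = (K * |t|) ^ (n + 1) / (n + 1).factorial * ‖x₀‖ := by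
          rw [MeasureTheory.integral_const_mul, integral_pow_abs_sub_uIoc, Nat.factorial_succ]
          push_cast
          rw [sub_zero]
          field_simp
          ring

/-- The solution is the Peano–Baker series. The exponential bound on its terms is uniform on bounded
intervals, so it can be differentiated term by term, each derivative being `A` applied to the
preceding term. -/
theorem exists_hasDerivAt_of_continuous_linear [CompleteSpace E] {A : ℝ → E →L[ℝ] E}
    (hA : Continuous A) {K : ℝ} (hK : ∀ t, ‖A t‖ ≤ K) (x₀ : E) :
    ∃ x : ℝ → E, x 0 = x₀ ∧ ∀ t, HasDerivAt x (A t (x t)) t := by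
  have hK0 : 0 ≤ K := (norm_nonneg _).trans (hK 0)
  set u := peanoBaker A x₀ with hu
  have hsum : ∀ t, Summable fun n => u n t := fun t =>
    .of_norm_bounded ((Real.summable_pow_div_factorial _).mul_right _)
      fun n => norm_peanoBaker_le hK x₀ n t
  have hder : ∀ n t, HasDerivAt (u (n + 1)) (A t (u n t)) t := fun n t =>
    ((hA.clm_apply (continuous_peanoBaker hA x₀ n)).integral_hasStrictDerivAt 0 t).hasDerivAt
  have hzero : ∀ n, u (n + 1) 0 = 0 := fun n => intervalIntegral.integral_same
  refine ⟨fun t => x₀ + ∑' n, u (n + 1) t, by simp [hzero], fun t => ?_⟩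
  have hmem : ∀ s, |s| < |t| + 1 → s ∈ Metric.ball (0 : ℝ) (|t| + 1) := fun s hs => by
    simpa using hs
  have h := hasDerivAt_tsum_of_isPreconnected (𝕜 := ℝ) (g := fun n => u (n + 1))
    (g' := fun n t => A t (u n t))
    (u := fun n => K * ((K * (|t| + 1)) ^ n / n.factorial * ‖x₀‖))
    (((Real.summable_pow_div_factorial _).mul_right _).mul_left _)
    (Metric.isOpen_ball (x := (0 : ℝ)) (ε := |t| + 1))
    (convex_ball _ _).isPreconnected (fun n s _ => hder n s)
    (fun n s hs => by
      have hs' : |s| ≤ |t| + 1 := by simpa using (Metric.mem_ball.1 hs).le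
      calc ‖A s (u n s)‖ ≤ ‖A s‖ * ‖u n s‖ := (A s).le_opNorm _
        _ ≤ K * ((K * |s|) ^ n / n.factorial * ‖x₀‖) :=
          mul_le_mul (hK s) (norm_peanoBaker_le hK x₀ n s) (norm_nonneg _) hK0
        _ ≤ _ := by gcongr)
    (hmem 0 (by simp; positivity)) ((summable_nat_add_iff 1).2 (hsum 0))
    (hmem t (by linarith))
  refine (h.const_add x₀).congr_deriv ?_
  rw [← (A t).map_tsum (hsum t), (hsum t).tsum_eq_zero_add]
  rfl

end Linear

/-! ### Basic theory of the Hill equation -/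

/-- The matrix of the first order system equivalent to `ξ'' + q ξ = 0`. -/
def hillField (q : ℝ) : ℝ × ℝ →L[ℝ] ℝ × ℝ :=
  (ContinuousLinearMap.inl ℝ ℝ ℝ).comp (ContinuousLinearMap.snd ℝ ℝ ℝ) -
    q • (ContinuousLinearMap.inr ℝ ℝ ℝ).comp (ContinuousLinearMap.fst ℝ ℝ ℝ)

lemma hillField_apply (q : ℝ) (x : ℝ × ℝ) : hillField q x = (x.2, -(q * x.1)) := by
  ext <;> simp [hillField]

lemma exists_norm_hillField_le {p : ℝ → ℝ} {M : ℝ} (hM : ∀ t, |p t| ≤ M) :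
    ∃ K, ∀ t, ‖hillField (p t)‖ ≤ K := by
  refine ⟨‖(ContinuousLinearMap.inl ℝ ℝ ℝ).comp (ContinuousLinearMap.snd ℝ ℝ ℝ)‖ +
    M * ‖(ContinuousLinearMap.inr ℝ ℝ ℝ).comp (ContinuousLinearMap.fst ℝ ℝ ℝ)‖,
    fun t => (norm_sub_le _ _).trans (add_le_add le_rfl ?_)⟩
  rw [norm_smul]
  exact mul_le_mul_of_nonneg_right (hM t) (norm_nonneg _)

theorem exists_isHillSolution {p : ℝ → ℝ} (hp : Continuous p) {M : ℝ} (hM : ∀ t, |p t| ≤ M)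
    (a b : ℝ) : ∃ ξ, IsHillSolution p ξ ∧ ξ 0 = a ∧ deriv ξ 0 = b := by
  obtain ⟨K, hK⟩ := exists_norm_hillField_le hM
  obtain ⟨x, hx0, hx⟩ := exists_hasDerivAt_of_continuous_linear
    (A := fun t => hillField (p t)) (by unfold hillField; fun_prop) hK (a, b)
  simp only [hillField_apply] at hx
  have h1 : ∀ t, HasDerivAt (fun t => (x t).1) (x t).2 t := fun t => (hx t).fst
  have h2 : ∀ t, HasDerivAt (fun t => (x t).2) (-(p t * (x t).1)) t := fun t => (hx t).snd
  have hd : deriv (fun t => (x t).1) = fun t => (x t).2 := funext fun t => (h1 t).deriv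
  exact ⟨fun t => (x t).1, ⟨fun t => (h1 t).differentiableAt, by rwa [hd]⟩, by simp [hx0],
    by simp [hd, hx0]⟩

namespace IsHillSolution

variable {p ξ η : ℝ → ℝ}

lemma hasDerivAt (h : IsHillSolution p ξ) (t : ℝ) : HasDerivAt ξ (deriv ξ t) t :=
  (h.differentiable t).hasDerivAt

lemma of_hasDerivAt {ξ' : ℝ → ℝ} (h1 : ∀ t, HasDerivAt ξ (ξ' t) t)
    (h2 : ∀ t, HasDerivAt ξ' (-(p t * ξ t)) t) : IsHillSolution p ξ := by
  have hd : deriv ξ = ξ' := funext fun t => (h1 t).deriv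
  exact ⟨fun t => (h1 t).differentiableAt, by rwa [hd]⟩

lemma unique (hξ : IsHillSolution p ξ) (hη : IsHillSolution p η) {M : ℝ} (hM : ∀ t, |p t| ≤ M)
    (h0 : ξ 0 = η 0) (h1 : deriv ξ 0 = deriv η 0) : ξ = η := by
  obtain ⟨K, hK⟩ := exists_norm_hillField_le hM
  have hK' : ∀ t, LipschitzOnWith K.toNNReal (hillField (p t)) univ := fun t =>
    ((hillField (p t)).lipschitz.weaken (by
      rw [← NNReal.coe_le_coe]; exact (hK t).trans (Real.le_coe_toNNReal K))).lipschitzOnWith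
  have hf : ∀ {ζ}, IsHillSolution p ζ → ∀ t, HasDerivAt (fun t => (ζ t, deriv ζ t))
      (hillField (p t) (ζ t, deriv ζ t)) t := fun hζ t => by
    rw [hillField_apply]; exact (hζ.hasDerivAt t).prodMk (hζ.eqn t)
  have h := ODE_solution_unique_univ (t₀ := 0) hK' (fun t => ⟨hf hξ t, mem_univ _⟩)
    (fun t => ⟨hf hη t, mem_univ _⟩) (by simp [h0, h1])
  funext t
  exact congrArg Prod.fst (congrFun h t)

lemma hasDerivAt_linear_comb (hξ : IsHillSolution p ξ) (hη : IsHillSolution p η) (a b t : ℝ) :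
    HasDerivAt (fun t => a * ξ t + b * η t) (a * deriv ξ t + b * deriv η t) t :=
  ((hξ.hasDerivAt t).const_mul a).add ((hη.hasDerivAt t).const_mul b)

lemma linear_comb (hξ : IsHillSolution p ξ) (hη : IsHillSolution p η) (a b : ℝ) :
    IsHillSolution p fun t => a * ξ t + b * η t :=
  of_hasDerivAt (hξ.hasDerivAt_linear_comb hη a b)
    fun t => (((hξ.eqn t).const_mul a).add ((hη.eqn t).const_mul b)).congr_deriv (by ring)

lemma hasDerivAt_comp_sub (hξ : IsHillSolution p ξ) (a t : ℝ) :
    HasDerivAt (fun t => ξ (a - t)) (-deriv ξ (a - t)) t := by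
  have := (hξ.hasDerivAt (a - t)).scomp t ((hasDerivAt_id t).const_sub a)
  refine this.congr_deriv ?_
  simp

lemma comp_sub (hξ : IsHillSolution p ξ) {a : ℝ} (hp : ∀ t, p (a - t) = p t) :
    IsHillSolution p fun t => ξ (a - t) :=
  of_hasDerivAt (hξ.hasDerivAt_comp_sub a) fun t => by
    have := ((hξ.eqn (a - t)).scomp t ((hasDerivAt_id t).const_sub a)).neg
    refine this.congr_deriv ?_
    simp [hp]

lemma wronskian_eq (hξ : IsHillSolution p ξ) (hη : IsHillSolution p η) (t : ℝ) :
    ξ t * deriv η t - deriv ξ t * η t = ξ 0 * deriv η 0 - deriv ξ 0 * η 0 := by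
  have h : ∀ t, HasDerivAt (fun t => ξ t * deriv η t - deriv ξ t * η t) 0 t := fun t =>
    (((hξ.hasDerivAt t).mul (hη.eqn t)).sub ((hξ.eqn t).mul (hη.hasDerivAt t))).congr_deriv
      (by ring)
  exact is_const_of_deriv_eq_zero (fun t => (h t).differentiableAt) (fun t => (h t).deriv) t 0

end IsHillSolution

/-- These are the Chebyshev values `T_n(d)`. For `|d| > 1` the increments of `|a n|` never fall
below `|d| - 1`, which gives at least linear growth. -/
lemma not_bounded_of_two_term_recurrence {a : ℕ → ℝ} {d : ℝ} (hd : 1 < |d|) (h0 : a 0 = 1)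
    (h1 : a 1 = d) (h : ∀ n, a (n + 2) + a n = 2 * d * a (n + 1)) :
    ¬ ∃ C, ∀ n, |a n| ≤ C := by
  have key : ∀ n, 1 ≤ |a n| ∧ |d| - 1 ≤ |a (n + 1)| - |a n| := by
    intro n
    induction n with
    | zero => simp [h0, h1]
    | succ n ih =>
      obtain ⟨i1, i2⟩ := ih
      have h2 : 2 * |d| * |a (n + 1)| ≤ |a (n + 2)| + |a n| := by
        have := abs_add_le (a (n + 2)) (a n)
        rwa [h n, abs_mul, abs_mul, abs_two] at this
      refine ⟨by linarith, ?_⟩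
      nlinarith
  rintro ⟨C, hC⟩
  have grow : ∀ n : ℕ, n * (|d| - 1) ≤ |a n| := by
    intro n
    induction n with
    | zero => simp
    | succ n ih => push_cast; linarith [(key n).2]
  obtain ⟨n, hn⟩ := exists_nat_gt (C / (|d| - 1))
  rw [div_lt_iff₀ (by linarith)] at hn
  linarith [grow n, hC n]

/-- Instability criterion for a Hill equation whose coefficient is symmetric about `0` and `h`,
in terms of the solutions `c`, `s` with `c 0 = 1`, `c' 0 = 0`, `s 0 = 0`, `s' 0 = 1`. -/
theorem not_hillStable_of_symmetric {p c s : ℝ → ℝ} {M h : ℝ} (hM : ∀ t, |p t| ≤ M)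
    (hp0 : ∀ t, p (0 - t) = p t) (hph : ∀ t, p (2 * h - t) = p t)
    (hc : IsHillSolution p c) (hc0 : c 0 = 1) (hc1 : deriv c 0 = 0)
    (hs : IsHillSolution p s) (hs0 : s 0 = 0) (hs1 : deriv s 0 = 1)
    (hpos : 0 < (c h * deriv s h) * (deriv c h * s h)) : ¬ HillStable p := by
  have hce : ∀ t, c (0 - t) = c t := fun t => congrFun ((hc.comp_sub hp0).unique hc hM (by simp)
    (by rw [(hc.hasDerivAt_comp_sub 0 0).deriv]; simp [hc1])) t
  -- Oddness of `s` is phrased as a linear combination so that `linear_comb` supplies the second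
  -- solution for uniqueness.
  have hso : ∀ t, s (0 - t) = -1 * s t + 0 * s t := fun t => by
    refine congrFun ((hs.comp_sub hp0).unique (hs.linear_comb hs (-1) 0) hM (by simp [hs0]) ?_) t
    rw [(hs.hasDerivAt_comp_sub 0 0).deriv]
    rw [(hs.hasDerivAt_linear_comb hs (-1) 0 0).deriv]
    simp
  set α := c (2 * h)
  set β := -deriv c (2 * h)
  -- Reflection about `h` preserves solutions; `α` and `β` are the Cauchy data of the reflected `c`
  -- at `0`. Value and slope at the fixed point `h`, combined with the unit Wronskian, express `α`
  -- through data at `h`.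
  have hrefl : (fun t => c (2 * h - t)) = fun t => α * c t + β * s t := by
    refine (hc.comp_sub hph).unique (hc.linear_comb hs α β) hM (by simp [hc0, hs0, α]) ?_
    rw [(hc.hasDerivAt_comp_sub _ _).deriv,
      (hc.hasDerivAt_linear_comb hs α β 0).deriv]
    simp [hc1, hs1, β]
  have e1 : c h = α * c h + β * s h := by
    have := congrFun hrefl h
    rwa [show 2 * h - h = h by ring] at this
  have e2 : -deriv c h = α * deriv c h + β * deriv s h := by
    have : deriv (fun t => c (2 * h - t)) h = deriv (fun t => α * c t + β * s t) h := by
      rw [hrefl]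
    rwa [(hc.hasDerivAt_comp_sub _ _).deriv,
      (hc.hasDerivAt_linear_comb hs α β h).deriv,
      show 2 * h - h = h by ring] at this
  have hw := hc.wronskian_eq hs h
  rw [hc0, hs1, hc1, zero_mul, mul_one, sub_zero] at hw
  have hα : α = c h * deriv s h + deriv c h * s h := by
    linear_combination (-deriv s h) * e1 + s h * e2 - α * hw
  have hα1 : 1 < |α| := by
    rw [← one_lt_sq_iff_one_lt_abs]
    have : α ^ 2 = 1 + 4 * ((c h * deriv s h) * (deriv c h * s h)) := by
      rw [hα]; linear_combination (c h * deriv s h - deriv c h * s h + 1) * hw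
    linarith
  -- Adding the reflection identity at `t` and `-t` cancels the odd part `β s`. This is
  -- Cayley–Hamilton for the monodromy, of determinant `1` and trace `2α`.
  have hrec : ∀ t, c (t + 2 * h) + c (t - 2 * h) = 2 * α * c t := fun t => by
    have r1 := congrFun hrefl t
    have r2 := congrFun hrefl (0 - t)
    have r3 := hce (t - 2 * h)
    simp only [hce t, hso t] at r1 r2
    rw [show 0 - (t - 2 * h) = 2 * h - t by ring] at r3
    rw [show 2 * h - (0 - t) = t + 2 * h by ring] at r2
    linarith
  intro hst
  obtain ⟨C, hC⟩ := hst c hc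
  refine not_bounded_of_two_term_recurrence (a := fun n : ℕ => c (n * (2 * h))) hα1
    (by simp [hc0]) (by simp [α]) (fun n => ?_) ⟨C, fun n => hC _⟩
  have := hrec ((n + 1) * (2 * h))
  push_cast
  rw [← this]
  congr 2 <;> ring

/-! ### Symmetries of the Jacobi elliptic functions -/

lemma ellipticF_neg (k φ : ℝ) : ellipticF k (-φ) = -ellipticF k φ := by
  unfold ellipticF
  have h := intervalIntegral.integral_comp_neg (a := 0) (b := φ)
    (fun θ : ℝ => 1 / Real.sqrt (1 - k ^ 2 * Real.sin θ ^ 2))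
  simp only [Real.sin_neg, neg_sq, neg_zero] at h
  rw [intervalIntegral.integral_symm, h]

lemma ellipticF_add_pi {k : ℝ} (hk : k ^ 2 < 1) (φ : ℝ) :
    ellipticF k (φ + Real.pi) = ellipticF k φ + ellipticF k Real.pi := by
  have hc : Continuous fun θ : ℝ => 1 / Real.sqrt (1 - k ^ 2 * Real.sin θ ^ 2) :=
    continuous_const.div (by fun_prop) fun θ => (Real.sqrt_pos.2 (one_sub_pos hk θ)).ne'
  have hper : Function.Periodic (fun θ : ℝ => 1 / Real.sqrt (1 - k ^ 2 * Real.sin θ ^ 2))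
      Real.pi := fun θ => by simp [Real.sin_add_pi]
  unfold ellipticF
  rw [← intervalIntegral.integral_add_adjacent_intervals (hc.intervalIntegrable 0 φ)
    (hc.intervalIntegrable φ _), hper.intervalIntegral_add_eq φ 0, zero_add]

lemma jacobiAm_ellipticF {k : ℝ} (hk : k ^ 2 < 1) (φ : ℝ) : jacobiAm (ellipticF k φ) k = φ :=
  Function.leftInverse_invFun (strictMono_ellipticF hk).injective φ

lemma jacobiAm_neg {k : ℝ} (hk : k ^ 2 < 1) (u : ℝ) : jacobiAm (-u) k = -jacobiAm u k := by
  conv_lhs => rw [← ellipticF_jacobiAm hk u, ← ellipticF_neg, jacobiAm_ellipticF hk]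

lemma jacobiAm_add {k : ℝ} (hk : k ^ 2 < 1) (u : ℝ) :
    jacobiAm (u + ellipticF k Real.pi) k = jacobiAm u k + Real.pi := by
  conv_lhs => rw [← ellipticF_jacobiAm hk u, ← ellipticF_add_pi hk, jacobiAm_ellipticF hk]

lemma strictMono_jacobiAm {k : ℝ} (hk : k ^ 2 < 1) : StrictMono fun u => jacobiAm u k :=
  fun u v huv => by
    rw [← (strictMono_ellipticF hk).lt_iff_lt, ellipticF_jacobiAm hk, ellipticF_jacobiAm hk]
    exact huv

lemma ellipticF_zero (k : ℝ) : ellipticF k 0 = 0 := by simp [ellipticF]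

lemma jacobiAm_zero {k : ℝ} (hk : k ^ 2 < 1) : jacobiAm 0 k = 0 := by
  simpa only [ellipticF_zero] using jacobiAm_ellipticF hk 0

/-- Evaluate the shift by `π` at `-π/2` and use oddness. -/
lemma ellipticF_pi_div_two {k : ℝ} (hk : k ^ 2 < 1) :
    ellipticF k (Real.pi / 2) = ellipticF k Real.pi / 2 := by
  have h := ellipticF_add_pi hk (-(Real.pi / 2))
  rw [ellipticF_neg, show -(Real.pi / 2) + Real.pi = Real.pi / 2 by ring] at h
  linarith

lemma ellipticF_pi_pos {k : ℝ} (hk : k ^ 2 < 1) : 0 < ellipticF k Real.pi := by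
  rw [← ellipticF_zero k]
  exact strictMono_ellipticF hk Real.pi_pos

/-! ### The Duffing oscillator -/

lemma duffing_eq (δ t : ℝ) :
    duffing δ t = δ * jacobiCn (t * Real.sqrt (1 + δ ^ 2)) (modulus δ) :=
  congrFun ((isDuffingSolution_duffing δ).unique (isDuffingSolution_cn δ)) t

/-- A quarter of the period of the Duffing oscillator: its first positive zero. -/
def quarterPeriod (δ : ℝ) : ℝ :=
  ellipticF (modulus δ) Real.pi / 2 / Real.sqrt (1 + δ ^ 2)

lemma sqrt_one_add_sq_pos (δ : ℝ) : 0 < Real.sqrt (1 + δ ^ 2) := Real.sqrt_pos.2 (by positivity)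

lemma quarterPeriod_pos (δ : ℝ) : 0 < quarterPeriod δ :=
  div_pos (half_pos (ellipticF_pi_pos (sq_modulus_lt_one δ))) (sqrt_one_add_sq_pos δ)

lemma quarterPeriod_mul (δ : ℝ) :
    quarterPeriod δ * Real.sqrt (1 + δ ^ 2) = ellipticF (modulus δ) Real.pi / 2 :=
  div_mul_cancel₀ _ (sqrt_one_add_sq_pos δ).ne'

lemma jacobiAm_quarterPeriod (δ : ℝ) :
    jacobiAm (quarterPeriod δ * Real.sqrt (1 + δ ^ 2)) (modulus δ) = Real.pi / 2 := by
  rw [quarterPeriod_mul, ← ellipticF_pi_div_two (sq_modulus_lt_one δ),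
    jacobiAm_ellipticF (sq_modulus_lt_one δ)]

lemma jacobiAm_add_two_quarterPeriod (δ t : ℝ) :
    jacobiAm ((t + 2 * quarterPeriod δ) * Real.sqrt (1 + δ ^ 2)) (modulus δ) =
      jacobiAm (t * Real.sqrt (1 + δ ^ 2)) (modulus δ) + Real.pi := by
  rw [← jacobiAm_add (sq_modulus_lt_one δ)]
  congr 1
  linear_combination 2 * quarterPeriod_mul δ

lemma duffing_antiperiodic (δ : ℝ) :
    Function.Antiperiodic (duffing δ) (2 * quarterPeriod δ) := fun t => by
  simp only [duffing_eq, jacobiCn, jacobiAm_add_two_quarterPeriod, Real.cos_add_pi]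
  ring

lemma jacobiSn_antiperiodic (δ : ℝ) : Function.Antiperiodic
    (fun t => jacobiSn (t * Real.sqrt (1 + δ ^ 2)) (modulus δ)) (2 * quarterPeriod δ) :=
  fun t => by simp only [jacobiSn, jacobiAm_add_two_quarterPeriod, Real.sin_add_pi]

lemma duffing_neg (δ t : ℝ) : duffing δ (-t) = duffing δ t := by
  simp only [duffing_eq, jacobiCn, neg_mul, jacobiAm_neg (sq_modulus_lt_one δ), Real.cos_neg]

lemma duffing_quarterPeriod (δ : ℝ) : duffing δ (quarterPeriod δ) = 0 := by
  simp [duffing_eq, jacobiCn, jacobiAm_quarterPeriod]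

lemma jacobiAm_mem_Icc {δ t : ℝ} (ht : t ∈ Icc 0 (quarterPeriod δ)) :
    jacobiAm (t * Real.sqrt (1 + δ ^ 2)) (modulus δ) ∈ Icc 0 (Real.pi / 2) := by
  have hm := (strictMono_jacobiAm (sq_modulus_lt_one δ)).monotone
  have hr := (sqrt_one_add_sq_pos δ).le
  constructor
  · rw [← jacobiAm_zero (sq_modulus_lt_one δ)]
    exact hm (mul_nonneg ht.1 hr)
  · rw [← jacobiAm_quarterPeriod δ]
    exact hm (mul_le_mul_of_nonneg_right ht.2 hr)

lemma duffing_strictAntiOn {δ : ℝ} (hδ : 0 < δ) :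
    StrictAntiOn (duffing δ) (Icc 0 (quarterPeriod δ)) := fun a ha b hb hab => by
  rw [duffing_eq, duffing_eq]
  refine mul_lt_mul_of_pos_left (Real.strictAntiOn_cos ?_ ?_ ?_) hδ
  · exact Icc_subset_Icc_right (by linarith [Real.pi_pos]) (jacobiAm_mem_Icc ha)
  · exact Icc_subset_Icc_right (by linarith [Real.pi_pos]) (jacobiAm_mem_Icc hb)
  · exact strictMono_jacobiAm (sq_modulus_lt_one δ)
      (mul_lt_mul_of_pos_right hab (sqrt_one_add_sq_pos δ))

lemma duffing_pos {δ t : ℝ} (hδ : 0 < δ) (ht : t ∈ Ico 0 (quarterPeriod δ)) : 0 < duffing δ t := by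
  rw [← duffing_quarterPeriod δ]
  exact duffing_strictAntiOn hδ (Ico_subset_Icc_self ht)
    (right_mem_Icc.2 (quarterPeriod_pos δ).le) ht.2

lemma duffing_sq_le (δ t : ℝ) : duffing δ t ^ 2 ≤ δ ^ 2 := by
  rw [duffing_eq, mul_pow]
  exact mul_le_of_le_one_right (sq_nonneg δ) (Real.cos_sq_le_one _)

/-- Half the period of `y` is the least period of `y²`. -/
theorem isLeast_period_duffing_sq {δ : ℝ} (hδ : 0 < δ) :
    IsLeast {s : ℝ | 0 < s ∧ Function.Periodic (fun t => duffing δ t ^ 2) s}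
      (2 * quarterPeriod δ) := by
  have hk := sq_modulus_lt_one δ
  refine ⟨⟨mul_pos two_pos (quarterPeriod_pos δ), fun t => ?_⟩, fun s hs => ?_⟩
  · simp only [duffing_antiperiodic δ t, neg_sq]
  · obtain ⟨hs0, hs⟩ := hs
    -- Comparison with time `0` suffices: `y(s)² = δ²` forces the amplitude at `s` to be a positive
    -- multiple of `π`, and the value `π` is reached at two quarter periods.
    have h := hs 0
    simp only [zero_add, (isDuffingSolution_duffing δ).init] at h
    rw [duffing_eq, mul_pow, mul_eq_left₀ (by positivity), jacobiCn, Real.cos_sq',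
      sub_eq_self, sq_eq_zero_iff, Real.sin_eq_zero_iff] at h
    obtain ⟨n, hn⟩ := h
    have hpos : 0 < jacobiAm (s * Real.sqrt (1 + δ ^ 2)) (modulus δ) := by
      rw [← jacobiAm_zero hk]
      exact strictMono_jacobiAm hk (mul_pos hs0 (sqrt_one_add_sq_pos δ))
    rw [← hn] at hpos
    have hn1 : (1 : ℝ) ≤ n := by
      have : (0 : ℝ) < n := pos_of_mul_pos_left hpos Real.pi_pos.le
      exact_mod_cast this
    have hle : jacobiAm ((0 + 2 * quarterPeriod δ) * Real.sqrt (1 + δ ^ 2)) (modulus δ) ≤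
        jacobiAm (s * Real.sqrt (1 + δ ^ 2)) (modulus δ) := by
      rw [jacobiAm_add_two_quarterPeriod, zero_mul, jacobiAm_zero hk, zero_add, ← hn]
      nlinarith [Real.pi_pos]
    have := (strictMono_jacobiAm hk).le_iff_le.1 hle
    rw [zero_add] at this
    exact le_of_mul_le_mul_right this (sqrt_one_add_sq_pos δ)

/-! ### The quadratic invariant of the Hill equation -/

lemma hasDerivAt_duffing (δ t : ℝ) : HasDerivAt (duffing δ) (deriv (duffing δ) t) t :=
  ((isDuffingSolution_duffing δ).differentiable t).hasDerivAt

lemma duffing_energy (δ t : ℝ) :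
    deriv (duffing δ) t ^ 2 + duffing δ t ^ 2 + duffing δ t ^ 4 / 2 = δ ^ 2 + δ ^ 4 / 2 := by
  have h := isDuffingSolution_duffing δ
  have hE : ∀ s, HasDerivAt
      (fun s => deriv (duffing δ) s ^ 2 + duffing δ s ^ 2 + duffing δ s ^ 4 / 2) 0 s := fun s => by
    refine ((((h.eqn s).pow 2).add ((hasDerivAt_duffing δ s).pow 2)).add
      (((hasDerivAt_duffing δ s).pow 4).div_const 2)).congr_deriv ?_
    norm_num
    ring
  have hc := is_const_of_deriv_eq_zero (fun s => (hE s).differentiableAt)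
    (fun s => (hE s).deriv) t 0
  simpa only [h.init, h.init_deriv, ne_eq, OfNat.ofNat_ne_zero, not_false_eq_true, zero_pow,
    zero_add] using hc

/-- The function `P = y² + 2 (1 - γ)`, a product of two solutions of the Hill equation. -/
def hillP (δ γ t : ℝ) : ℝ := duffing δ t ^ 2 + 2 * (1 - γ)

/-- The coefficient `P''/2 + (γ + y²) P` of `ξ²` in the quadratic invariant. -/
def hillR (δ γ t : ℝ) : ℝ :=
  δ ^ 2 + δ ^ 4 / 2 - 2 * duffing δ t ^ 2 - 3 / 2 * duffing δ t ^ 4 + coeff δ γ t * hillP δ γ t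

/-- The bilinear form `P ξ' η' - (P'/2) (ξ' η + ξ η') + (P''/2 + (γ + y²) P) ξ η`, which is
constant along solutions `ξ`, `η` of the Hill equation. -/
def hillForm (δ γ : ℝ) (ξ η : ℝ → ℝ) (t : ℝ) : ℝ :=
  hillP δ γ t * (deriv ξ t * deriv η t)
    - duffing δ t * deriv (duffing δ) t * (deriv ξ t * η t + ξ t * deriv η t)
    + hillR δ γ t * (ξ t * η t)

/-- The discriminant `4 (1 - γ) (1 + δ²/2 - γ) (γ + δ²/2)` of the quadratic invariant. -/
def hillW (δ γ : ℝ) : ℝ := 4 * (1 - γ) * (1 + δ ^ 2 / 2 - γ) * (γ + δ ^ 2 / 2)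

lemma hillP_mul_hillR (δ γ t : ℝ) : hillP δ γ t * hillR δ γ t -
    (duffing δ t * deriv (duffing δ) t) ^ 2 = hillW δ γ := by
  unfold hillP hillR hillW coeff hillP
  linear_combination (-duffing δ t ^ 2) * duffing_energy δ t

lemma hasDerivAt_hillP (δ γ t : ℝ) :
    HasDerivAt (hillP δ γ) (2 * duffing δ t * deriv (duffing δ) t) t := by
  refine (((hasDerivAt_duffing δ t).pow 2).add_const (2 * (1 - γ))).congr_deriv ?_
  norm_num

/-- With `R = P''/2 + qP`, the identity `R' = -qP'` is a restatement of `P''' + 4qP' + 2q'P = 0`. -/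
lemma hasDerivAt_hillR (δ γ t : ℝ) : HasDerivAt (hillR δ γ)
    (-2 * coeff δ γ t * (duffing δ t * deriv (duffing δ) t)) t := by
  have hy := hasDerivAt_duffing δ t
  refine ((((((hy.pow 2).const_mul 2).const_sub (δ ^ 2 + δ ^ 4 / 2)).sub
    ((hy.pow 4).const_mul (3 / 2)))).add
    (((hy.pow 2).const_add γ).mul (hasDerivAt_hillP δ γ t))).congr_deriv ?_
  simp only [coeff, hillP, Pi.pow_apply]
  norm_num
  ring

lemma hillForm_eq {δ γ : ℝ} {ξ η : ℝ → ℝ} (hξ : IsHillSolution (coeff δ γ) ξ)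
    (hη : IsHillSolution (coeff δ γ) η) (t : ℝ) :
    hillForm δ γ ξ η t = hillForm δ γ ξ η 0 := by
  have h : ∀ t, HasDerivAt (hillForm δ γ ξ η) 0 t := fun t => by
    have hy := hasDerivAt_duffing δ t
    have hy' := (isDuffingSolution_duffing δ).eqn t
    refine ((((hasDerivAt_hillP δ γ t).mul ((hξ.eqn t).mul (hη.eqn t))).sub
      ((hy.mul hy').mul (((hξ.eqn t).mul (hη.hasDerivAt t)).add
        ((hξ.hasDerivAt t).mul (hη.eqn t))))).add
      ((hasDerivAt_hillR δ γ t).mul ((hξ.hasDerivAt t).mul (hη.hasDerivAt t)))).congr_deriv ?_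
    simp only [coeff, hillP, hillR, Pi.mul_apply, Pi.add_apply]
    -- Energy is needed because `hillR` contains `P''/2` with `y'²` already eliminated.
    linear_combination (-(deriv ξ t * η t + ξ t * deriv η t)) * duffing_energy δ t
  exact is_const_of_deriv_eq_zero (fun t => (h t).differentiableAt) (fun t => (h t).deriv) t 0

/-- Completing the square. For `W > 0` it bounds `ξ²` by `P Q / W`; for `W ≤ 0` it makes `P Q ≤ 0`
wherever the square vanishes. -/
lemma hillP_mul_hillForm (δ γ : ℝ) (ξ : ℝ → ℝ) (t : ℝ) :
    hillP δ γ t * hillForm δ γ ξ ξ t =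
      (hillP δ γ t * deriv ξ t - duffing δ t * deriv (duffing δ) t * ξ t) ^ 2
        + hillW δ γ * ξ t ^ 2 := by
  rw [← hillP_mul_hillR δ γ t, hillForm]
  ring

/-! ### Stability and instability -/

theorem hillStable_of_pos {δ γ : ℝ} (hW : 0 < hillW δ γ) : HillStable (coeff δ γ) := by
  intro ξ hξ
  set Q := hillForm δ γ ξ ξ 0
  set M := δ ^ 2 + |2 * (1 - γ)|
  refine ⟨Real.sqrt (M * |Q| / hillW δ γ), fun t => Real.abs_le_sqrt ?_⟩
  rw [le_div_iff₀ hW]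
  have h := hillP_mul_hillForm δ γ ξ t
  rw [hillForm_eq hξ hξ t] at h
  have hP : |hillP δ γ t| ≤ M := by
    refine (abs_add_le _ _).trans (add_le_add ?_ le_rfl)
    rw [abs_of_nonneg (sq_nonneg _)]
    exact duffing_sq_le δ t
  have hPQ : hillP δ γ t * Q ≤ M * |Q| := by
    refine (le_abs_self _).trans ?_
    rw [abs_mul]
    exact mul_le_mul_of_nonneg_right hP (abs_nonneg _)
  nlinarith [sq_nonneg (hillP δ γ t * deriv ξ t - duffing δ t * deriv (duffing δ) t * ξ t)]

lemma coeff_bounded (δ γ t : ℝ) : |coeff δ γ t| ≤ |γ| + δ ^ 2 := by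
  refine (abs_add_le _ _).trans (add_le_add le_rfl ?_)
  rw [abs_of_nonneg (sq_nonneg _)]
  exact duffing_sq_le δ t

lemma continuous_coeff (δ γ : ℝ) : Continuous (coeff δ γ) :=
  continuous_const.add ((isDuffingSolution_duffing δ).differentiable.continuous.pow 2)

lemma hillP_quarterPeriod (δ γ : ℝ) : hillP δ γ (quarterPeriod δ) = 2 * (1 - γ) := by
  simp [hillP, duffing_quarterPeriod]

lemma hillR_quarterPeriod (δ γ : ℝ) : hillR δ γ (quarterPeriod δ) =
    2 * ((1 + δ ^ 2 / 2 - γ) * (γ + δ ^ 2 / 2)) := by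
  simp only [hillR, coeff, hillP_quarterPeriod, duffing_quarterPeriod]
  ring

lemma hillForm_zero (δ γ : ℝ) (ξ η : ℝ → ℝ) : hillForm δ γ ξ η 0 =
    hillP δ γ 0 * (deriv ξ 0 * deriv η 0) + hillR δ γ 0 * (ξ 0 * η 0) := by
  simp [hillForm, (isDuffingSolution_duffing δ).init_deriv]

/-- The mixed term carries the factor `P'/2 = y y'`, which vanishes here since `y` does, and at `0`
since `y'` does. -/
lemma hillForm_quarterPeriod (δ γ : ℝ) (ξ η : ℝ → ℝ) :
    hillForm δ γ ξ η (quarterPeriod δ) =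
      2 * (1 - γ) * (deriv ξ (quarterPeriod δ) * deriv η (quarterPeriod δ)) +
      2 * ((1 + δ ^ 2 / 2 - γ) * (γ + δ ^ 2 / 2)) *
        (ξ (quarterPeriod δ) * η (quarterPeriod δ)) := by
  simp [hillForm, duffing_quarterPeriod, hillP_quarterPeriod, hillR_quarterPeriod]

/-- A solution with negative invariant has at most one zero on an interval on which `P < 0`. -/
lemma not_two_zeros_of_hillP_neg {δ γ a b : ℝ} {c : ℝ → ℝ} (hc : IsHillSolution (coeff δ γ) c)
    (hQ : hillForm δ γ c c 0 < 0) (hW : hillW δ γ ≤ 0) (hab : a < b)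
    (hP : ∀ t ∈ Icc a b, hillP δ γ t < 0) (ha : c a = 0) (hb : c b = 0) : False := by
  -- By Rolle for `c / √(-P)`, somewhere `P c' = y y' c`. The completed square then reads `P Q = W
  -- c² ≤ 0`, against `P < 0` and `Q < 0`.
  have hder : ∀ t ∈ Icc a b, HasDerivAt (fun t => c t / Real.sqrt (-hillP δ γ t))
      ((deriv c t * Real.sqrt (-hillP δ γ t) - c t * (-(2 * duffing δ t * deriv (duffing δ) t) /
        (2 * Real.sqrt (-hillP δ γ t)))) / Real.sqrt (-hillP δ γ t) ^ 2) t := fun t ht => by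
    have hp : 0 < -hillP δ γ t := neg_pos.2 (hP t ht)
    exact (hc.hasDerivAt t).div ((hasDerivAt_hillP δ γ t).neg.sqrt hp.ne') (Real.sqrt_pos.2 hp).ne'
  obtain ⟨t, ht, h0⟩ := exists_hasDerivAt_eq_zero hab
    (fun t ht => (hder t ht).continuousAt.continuousWithinAt) (by simp [ha, hb])
    fun t ht => hder t (Ioo_subset_Icc_self ht)
  have hPt := hP t (Ioo_subset_Icc_self ht)
  have hp : 0 < -hillP δ γ t := neg_pos.2 hPt
  have hr := Real.sqrt_pos.2 hp
  have hr2 := Real.sq_sqrt hp.le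
  set r := Real.sqrt (-hillP δ γ t)
  have hN : hillP δ γ t * deriv c t - duffing δ t * deriv (duffing δ) t * c t = 0 := by
    field_simp at h0
    linear_combination deriv c t * hr2 - h0
  have h := hillP_mul_hillForm δ γ c t
  rw [hillForm_eq hc hc t, hN] at h
  nlinarith [mul_pos_of_neg_of_neg hPt hQ, mul_nonneg (neg_nonneg.2 hW) (sq_nonneg (c t))]

/-- The sign of `Q(c)` alone does not exclude a zero at `h`. If `c(h) = 0`, comparison with `y`
yields an earlier zero `t` in `(0, h)`, where `Q = P c'²` is negative, so `P(t) < 0`. As `y`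
decreases to `0` on `[0, h]`, `P` stays negative on `[t, h]`, which cannot contain two zeros of `c`.
-/
lemma ne_zero_at_quarterPeriod {δ γ : ℝ} (hδ : 0 < δ) (h1 : 1 < γ) (h2 : γ < 1 + δ ^ 2 / 2)
    {c : ℝ → ℝ} (hc : IsHillSolution (coeff δ γ) c) (hc1 : deriv c 0 = 0)
    (hQ : hillForm δ γ c c 0 < 0) : c (quarterPeriod δ) ≠ 0 := by
  intro hch
  set h := quarterPeriod δ
  have hh0 : 0 < h := quarterPeriod_pos δ
  have hd := isDuffingSolution_duffing δ
  -- `y` solves the Hill equation with `γ = 1`, so this mixed Wronskian has derivative `(1 - γ) c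
  -- y`; it vanishes at both ends of `[0, h]`.
  have hF : ∀ t, HasDerivAt (fun t => deriv c t * duffing δ t - c t * deriv (duffing δ) t)
      ((1 - γ) * (c t * duffing δ t)) t := fun t => by
    refine (((hc.eqn t).mul (hasDerivAt_duffing δ t)).sub
      ((hc.hasDerivAt t).mul (hd.eqn t))).congr_deriv ?_
    simp only [coeff]
    ring
  have hyh : duffing δ h = 0 := duffing_quarterPeriod δ
  obtain ⟨t, ht, ht0⟩ := exists_hasDerivAt_eq_zero hh0
    (fun t _ => (hF t).continuousAt.continuousWithinAt)
    (by simp [hc1, hd.init_deriv, hch, hyh]) fun t _ => hF t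
  have hct : c t = 0 := by
    have hy := duffing_pos hδ (Ioo_subset_Ico_self ht)
    rcases mul_eq_zero.1 ht0 with h0 | h0
    · linarith
    · exact (mul_eq_zero.1 h0).resolve_right hy.ne'
  have hPt : hillP δ γ t < 0 := by
    have hq := hillForm_eq hc hc t
    simp only [hillForm, hct, mul_zero, zero_mul, add_zero, sub_zero] at hq
    change _ = hillForm δ γ c c 0 at hq
    nlinarith [mul_self_nonneg (deriv c t)]
  refine not_two_zeros_of_hillP_neg hc hQ ?_ ht.2 (fun s hs => ?_) hct hch
  · unfold hillW
    have : 0 < (1 + δ ^ 2 / 2 - γ) * (γ + δ ^ 2 / 2) := by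
      have := sq_nonneg δ
      exact mul_pos (by linarith) (by linarith)
    nlinarith
  · refine lt_of_le_of_lt ?_ hPt
    have hs0 : 0 ≤ s := ht.1.le.trans hs.1
    have hle : duffing δ s ≤ duffing δ t := (duffing_strictAntiOn hδ).antitoneOn
      (Ioo_subset_Icc_self ht) ⟨hs0, hs.2⟩ hs.1
    have hy0 : 0 ≤ duffing δ s := by
      rw [← duffing_quarterPeriod δ]
      exact (duffing_strictAntiOn hδ).antitoneOn ⟨hs0, hs.2⟩ (right_mem_Icc.2 hh0.le) hs.2
    unfold hillP
    gcongr

theorem not_hillStable {δ γ : ℝ} (hδ : 0 < δ) (h1 : 1 < γ) (h2 : γ < 1 + δ ^ 2 / 2) :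
    ¬ HillStable (coeff δ γ) := by
  obtain ⟨c, hc, hc0, hc1⟩ :=
    exists_isHillSolution (continuous_coeff δ γ) (coeff_bounded δ γ) 1 0
  obtain ⟨s, hs, hs0, hs1⟩ :=
    exists_isHillSolution (continuous_coeff δ γ) (coeff_bounded δ γ) 0 1
  have hR : 0 < (1 + δ ^ 2 / 2 - γ) * (γ + δ ^ 2 / 2) := by
    have := sq_nonneg δ
    exact mul_pos (by linarith) (by linarith)
  have hP0 : 0 < hillP δ γ 0 := by
    simp only [hillP, (isDuffingSolution_duffing δ).init]
    linarith
  have hR0 : hillR δ γ 0 < 0 := by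
    have h := hillP_mul_hillR δ γ 0
    rw [(isDuffingSolution_duffing δ).init_deriv] at h
    unfold hillW at h
    have hW : hillP δ γ 0 * hillR δ γ 0 < 0 := by nlinarith
    exact neg_of_mul_neg_right hW hP0.le
  have hcc := hillForm_zero δ γ c c
  have hcs := hillForm_zero δ γ c s
  have hss := hillForm_zero δ γ s s
  simp only [hc0, hc1, hs0, hs1, mul_zero, mul_one, zero_add, add_zero] at hcc hcs hss
  have hch := ne_zero_at_quarterPeriod hδ h1 h2 hc hc1 (by rw [hcc]; exact hR0)
  -- Here signs suffice: `Q(s) = P(0) > 0`, while a zero at `h` would give `Q(s) = 2(1 - γ) s'(h)² ≤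
  -- 0`.
  have hsh : s (quarterPeriod δ) ≠ 0 := fun h0 => by
    rw [← hillForm_eq hs hs (quarterPeriod δ), hillForm_quarterPeriod, h0] at hss
    nlinarith [mul_self_nonneg (deriv s (quarterPeriod δ))]
  rw [← hillForm_eq hc hs (quarterPeriod δ), hillForm_quarterPeriod] at hcs
  refine not_hillStable_of_symmetric (h := quarterPeriod δ) (coeff_bounded δ γ) (fun t => ?_)
    (fun t => ?_) hc hc0 hc1 hs hs0 hs1 ?_
  · simp only [coeff, zero_sub, duffing_neg]
  · have := duffing_antiperiodic δ (-t)
    rw [duffing_neg, show -t + 2 * quarterPeriod δ = 2 * quarterPeriod δ - t by ring] at this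
    simp only [coeff, this, neg_sq]
  · set C := c (quarterPeriod δ)
    set S := s (quarterPeriod δ)
    set C' := deriv c (quarterPeriod δ)
    set S' := deriv s (quarterPeriod δ)
    have hCS : 0 < (C * S) ^ 2 := by positivity
    -- The polarized form vanishes on `(c, s)` at `0`, hence at `h`; this is that relation
    -- multiplied by `C * S`.
    have hprod : (γ - 1) * ((C * S') * (C' * S)) =
        (1 + δ ^ 2 / 2 - γ) * (γ + δ ^ 2 / 2) * (C * S) ^ 2 := by
      linear_combination (-C * S / 2) * hcs
    exact pos_of_mul_pos_right (hprod ▸ mul_pos hR hCS) (by linarith)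

/-! ### The resonance tongue -/

lemma hillW_pos_of_lt_one {δ γ : ℝ} (hδ : 0 < δ) (h0 : 0 ≤ γ) (h1 : γ < 1) : 0 < hillW δ γ := by
  have := sq_pos_of_pos hδ
  unfold hillW
  exact mul_pos (mul_pos (by linarith) (by linarith)) (by linarith)

lemma hillW_pos_of_gt {δ γ : ℝ} (h : 1 + δ ^ 2 / 2 < γ) : 0 < hillW δ γ := by
  have := sq_nonneg δ
  unfold hillW
  exact mul_pos (mul_pos_of_neg_of_neg (by linarith) (by linarith)) (by linarith)

/-- The region between the line `γ = 1` and the parabola `γ = 1 + δ²/2`. -/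
def tongue : Set (ℝ × ℝ) := {x | 0 < x.1 ∧ 1 < x.2 ∧ x.2 < 1 + x.1 ^ 2 / 2}

lemma isOpen_tongue : IsOpen tongue :=
  (isOpen_lt continuous_const continuous_fst).inter
    ((isOpen_lt continuous_const continuous_snd).inter
      (isOpen_lt continuous_snd (by fun_prop)))

lemma tongue_subset_interior : tongue ⊆ interior unstableSet :=
  interior_maximal (fun _ hx => ⟨hx.1, not_hillStable hx.1 hx.2.1 hx.2.2⟩) isOpen_tongue

/-- Rescaling each vertical fibre to `(0, 1)` straightens the region into a product of intervals,
which gives connectedness. -/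
lemma tongue_eq_image :
    tongue = (fun x : ℝ × ℝ => (x.1, 1 + x.2 * (x.1 ^ 2 / 2))) '' (Ioi 0 ×ˢ Ioo 0 1) := by
  ext ⟨δ, γ⟩
  simp only [tongue, mem_ofPred, mem_image, mem_prod, mem_Ioi, mem_Ioo, Prod.mk.injEq, Prod.exists]
  constructor
  · rintro ⟨hδ, h1, h2⟩
    have hq : 0 < δ ^ 2 / 2 := by positivity
    refine ⟨δ, (γ - 1) / (δ ^ 2 / 2), ⟨hδ, div_pos (by linarith) hq, ?_⟩, rfl, ?_⟩
    · rw [div_lt_one hq]; linarith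
    · rw [div_mul_cancel₀ _ hq.ne']; ring
  · rintro ⟨δ', s, ⟨hδ, h0, h1⟩, rfl, rfl⟩
    have hq : 0 < δ' ^ 2 / 2 := by positivity
    exact ⟨hδ, by nlinarith, by nlinarith⟩

lemma isPreconnected_tongue : IsPreconnected tongue := by
  rw [tongue_eq_image]
  exact (isPreconnected_Ioi.prod isPreconnected_Ioo).image _ (by fun_prop)

lemma mem_closure_tongue_of_tendsto {x : ℝ × ℝ} {f : ℝ → ℝ × ℝ} (hf : Continuous f)
    (hx : f 0 = x) {ε : ℝ} (hε : 0 < ε) (h : ∀ s ∈ Ioo 0 ε, f s ∈ tongue) : x ∈ closure tongue := by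
  refine mem_closure_of_tendsto (f := f) (b := 𝓝[>] 0) ?_ ?_
  · rw [← hx]; exact hf.continuousAt.tendsto.mono_left nhdsWithin_le_nhds
  · filter_upwards [Ioo_mem_nhdsGT hε] with s hs using h s hs

lemma zero_one_mem_closure_tongue : ((0 : ℝ), (1 : ℝ)) ∈ closure tongue := by
  refine mem_closure_tongue_of_tendsto (f := fun s => (s, 1 + s ^ 2 / 4)) (by fun_prop) (by simp)
    one_pos fun s hs => ?_
  have : 0 < s ^ 2 := by have := hs.1; positivity
  exact ⟨hs.1, by simp only; linarith, by simp only; linarith⟩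

/-- A point cannot be interior to the unstable set if it is approached vertically by stable
parameters. -/
lemma notMem_interior_of_stable {δ γ σ : ℝ} {ε : ℝ} (hε : 0 < ε)
    (h : ∀ s ∈ Ioo 0 ε, HillStable (coeff δ (γ + σ * s))) : (δ, γ) ∉ interior unstableSet := by
  intro hx
  have hcont : Continuous fun s : ℝ => (δ, γ + σ * s) := by fun_prop
  have hev : ∀ᶠ s in 𝓝[>] (0 : ℝ), (δ, γ + σ * s) ∈ unstableSet :=
    nhdsWithin_le_nhds (hcont.continuousAt.eventually_mem (by
      simpa using mem_interior_iff_mem_nhds.1 hx))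
  obtain ⟨s, hs1, hs2⟩ := (hev.and (Ioo_mem_nhdsGT hε)).exists
  exact hs1.2 (h s hs2)

/-- Off the two curves `W > 0` gives stability. Points on the curves, whatever their own stability,
are limits of stable parameters: from below on the line, from above on the parabola. -/
lemma mem_tongue_of_mem_interior {x : ℝ × ℝ} (hx : x ∈ interior unstableSet) (h0 : 0 ≤ x.2) :
    x ∈ tongue := by
  obtain ⟨δ, γ⟩ := x
  have hI := interior_subset hx
  have hδ : 0 < δ := hI.1
  simp only at h0
  refine ⟨hδ, ?_, ?_⟩ <;> by_contra! hcon <;> simp only at hcon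
  · rcases hcon.lt_or_eq with hlt | rfl
    · exact hI.2 (hillStable_of_pos (hillW_pos_of_lt_one hδ h0 hlt))
    · exact notMem_interior_of_stable (σ := -1) one_pos (fun s hs => hillStable_of_pos
        (hillW_pos_of_lt_one hδ (by linarith [hs.2]) (by linarith [hs.1]))) hx
  · rcases hcon.lt_or_eq with hlt | rfl
    · exact hI.2 (hillStable_of_pos (hillW_pos_of_gt hlt))
    · exact notMem_interior_of_stable (σ := 1) one_pos (fun s hs => hillStable_of_pos
        (hillW_pos_of_gt (by linarith [hs.1]))) hx

theorem resonanceTongue_one : resonanceTongue 1 = tongue := by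
  ext x
  simp only [resonanceTongue, mem_ofPred, Nat.cast_one, one_pow]
  constructor
  · rintro ⟨hx, hcl⟩
    by_contra hxt
    have hneg : x.2 < 0 := by
      by_contra! h0
      exact hxt (mem_tongue_of_mem_interior hx h0)
    -- The level `1/2` separates: a component rising above it from `γ < 0` would contain a point
    -- with `γ = 1/2`, which would have to lie in the tongue, where `γ > 1`.
    have hsub : connectedComponentIn (interior unstableSet) x ⊆ {z | z.2 ≤ 1 / 2} := by
      intro z hz
      by_contra! hz2
      simp only [mem_ofPred, not_le] at hz2
      obtain ⟨w, hw, hw2⟩ := (isPreconnected_connectedComponentIn (x := x)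
        (F := interior unstableSet)).intermediate_value (mem_connectedComponentIn hx) hz
        continuous_snd.continuousOn ⟨by linarith, hz2.le⟩
      have := (mem_tongue_of_mem_interior (connectedComponentIn_subset _ _ hw)
        (by rw [hw2]; norm_num)).2.1
      rw [hw2] at this
      norm_num at this
    have := closure_minimal hsub (isClosed_le continuous_snd continuous_const) hcl
    norm_num at this
  · intro hx
    exact ⟨tongue_subset_interior hx, closure_mono (isPreconnected_tongue.subset_connectedComponentIn
      hx tongue_subset_interior) zero_one_mem_closure_tongue⟩

lemma frontier_tongue : frontier tongue ∩ {x : ℝ × ℝ | 0 < x.1} =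
    {x : ℝ × ℝ | 0 < x.1 ∧ (x.2 = 1 ∨ x.2 = 1 + x.1 ^ 2 / 2)} := by
  ext ⟨δ, γ⟩
  rw [isOpen_tongue.frontier_eq]
  simp only [mem_inter_iff, mem_sdiff, mem_ofPred]
  constructor
  · rintro ⟨⟨hcl, hn⟩, hδ⟩
    have h1 : 1 ≤ γ := closure_minimal (fun x hx => hx.2.1.le)
      (isClosed_le (continuous_const (y := (1 : ℝ))) continuous_snd) hcl
    have h2 : γ ≤ 1 + δ ^ 2 / 2 := closure_minimal (fun x hx => hx.2.2.le)
      (isClosed_le continuous_snd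
        (by fun_prop : Continuous fun x : ℝ × ℝ => 1 + x.1 ^ 2 / 2)) hcl
    refine ⟨hδ, ?_⟩
    by_contra! hcon
    exact hn ⟨hδ, lt_of_le_of_ne h1 (Ne.symm hcon.1), lt_of_le_of_ne h2 hcon.2⟩
  · rintro ⟨hδ, h⟩
    have hq : 0 < δ ^ 2 / 2 := by positivity
    refine ⟨⟨?_, fun ht => ?_⟩, hδ⟩
    -- Both curves are approached vertically; `δ² / 2` is the height of the fibre.
    · rcases h with rfl | rfl
      · exact mem_closure_tongue_of_tendsto (f := fun s => (δ, 1 + s)) (by fun_prop) (by simp) hq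
          fun s hs => ⟨hδ, by linarith [hs.1], by linarith [hs.2]⟩
      · exact mem_closure_tongue_of_tendsto (f := fun s => (δ, 1 + δ ^ 2 / 2 - s)) (by fun_prop)
          (by simp) hq fun s hs => ⟨hδ, by linarith [hs.2], by linarith [hs.1]⟩
    · have h1 := ht.2.1
      have h2 := ht.2.2
      simp only at h1 h2
      rcases h with rfl | rfl <;> linarith

/-! ### The solutions at the boundary of the tongue -/

lemma isHillSolution_duffing (δ : ℝ) : IsHillSolution (coeff δ 1) (duffing δ) :=
  ⟨(isDuffingSolution_duffing δ).differentiable, fun t =>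
    ((isDuffingSolution_duffing δ).eqn t).congr_deriv (by simp only [coeff]; ring)⟩

/-- From `sn'' = -(1 + k²) sn + 2k² sn³`, with `r² = 1 + δ²` and `k² r² = δ²/2`, the coefficient is
`1 + 3δ²/2 - δ² sn²`, which equals `1 + δ²/2 + δ² cn²`, and `y = δ cn`. -/
lemma isHillSolution_jacobiSn (δ : ℝ) : IsHillSolution (coeff δ (1 + δ ^ 2 / 2))
    fun t => jacobiSn (t * Real.sqrt (1 + δ ^ 2)) (modulus δ) := by
  have hk := sq_modulus_lt_one δ
  set k := modulus δ with hkdef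
  set r := Real.sqrt (1 + δ ^ 2) with hr
  have hr2 : r ^ 2 = 1 + δ ^ 2 := Real.sq_sqrt (by positivity)
  have hkr : k ^ 2 * r ^ 2 = δ ^ 2 / 2 := by
    rw [hkdef, sq_modulus, hr2]; field_simp
  have hlin : ∀ t : ℝ, HasDerivAt (fun t : ℝ => t * r) r t := fun t => by
    simpa using (hasDerivAt_id t).mul_const r
  have hcn : ∀ t : ℝ, HasDerivAt (fun t => jacobiCn (t * r) k)
      ((-jacobiSn (t * r) k * jacobiDn (t * r) k) * r) t := fun t =>
    HasDerivAt.comp (h₂ := fun u => jacobiCn u k) (h := fun t : ℝ => t * r) t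
      (hasDerivAt_jacobiCn hk (t * r)) (hlin t)
  have hsn : ∀ t : ℝ, HasDerivAt (fun t => jacobiSn (t * r) k)
      ((jacobiCn (t * r) k * jacobiDn (t * r) k) * r) t := fun t =>
    HasDerivAt.comp (h₂ := fun u => jacobiSn u k) (h := fun t : ℝ => t * r) t
      (hasDerivAt_jacobiSn hk (t * r)) (hlin t)
  have hdn : ∀ t : ℝ, HasDerivAt (fun t => jacobiDn (t * r) k)
      ((-k ^ 2 * jacobiCn (t * r) k * jacobiSn (t * r) k) * r) t := fun t =>
    HasDerivAt.comp (h₂ := fun u => jacobiDn u k) (h := fun t : ℝ => t * r) t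
      (hasDerivAt_jacobiDn hk (t * r)) (hlin t)
  refine .of_hasDerivAt hsn fun t => (((hcn t).mul (hdn t)).mul_const r).congr_deriv ?_
  have hd2 := sq_jacobiDn hk (t * r)
  have hcs : jacobiSn (t * r) k ^ 2 + jacobiCn (t * r) k ^ 2 = 1 := Real.sin_sq_add_cos_sq _
  rw [coeff, duffing_eq]
  set c := jacobiCn (t * r) k
  set s := jacobiSn (t * r) k
  set d := jacobiDn (t * r) k
  linear_combination (-s * r ^ 2) * hd2 + (k ^ 2 * r ^ 2 * s) * hcs
    + (-s) * hr2 + (s - 2 * c ^ 2 * s) * hkr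

lemma jacobiSn_quarterPeriod (δ : ℝ) :
    jacobiSn (quarterPeriod δ * Real.sqrt (1 + δ ^ 2)) (modulus δ) = 1 := by
  simp [jacobiSn, jacobiAm_quarterPeriod]

end DuffingHill

end

theorem theorem3p2 :
    DuffingHill.resonanceTongue 1 =
      {x : ℝ × ℝ | 0 < x.1 ∧ 0 < x.2 ∧ 1 < x.2 ∧ x.2 < 1 + x.1 ^ 2 / 2} ∧
    frontier (DuffingHill.resonanceTongue 1) ∩ {x : ℝ × ℝ | 0 < x.1} =
      {x : ℝ × ℝ | 0 < x.1 ∧ (x.2 = 1 ∨ x.2 = 1 + x.1 ^ 2 / 2)} ∧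
    ∀ δ : ℝ, 0 < δ →
      ∃ τ : ℝ,
        IsLeast {s : ℝ | 0 < s ∧ Function.Periodic (fun t => DuffingHill.duffing δ t ^ 2) s} τ ∧
        (DuffingHill.IsHillSolution (DuffingHill.coeff δ 1) (DuffingHill.duffing δ) ∧
          DuffingHill.duffing δ ≠ 0 ∧
          Function.Antiperiodic (DuffingHill.duffing δ) τ) ∧
        (DuffingHill.IsHillSolution (DuffingHill.coeff δ (1 + δ ^ 2 / 2))
            (fun t => DuffingHill.jacobiSn (t * Real.sqrt (1 + δ ^ 2)) (DuffingHill.modulus δ)) ∧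
          (fun t => DuffingHill.jacobiSn (t * Real.sqrt (1 + δ ^ 2)) (DuffingHill.modulus δ)) ≠ 0 ∧
          Function.Antiperiodic
            (fun t => DuffingHill.jacobiSn (t * Real.sqrt (1 + δ ^ 2)) (DuffingHill.modulus δ))
            τ) := by
  have hU : DuffingHill.resonanceTongue 1 = DuffingHill.tongue := DuffingHill.resonanceTongue_one
  refine ⟨?_, ?_, fun δ hδ => ⟨2 * DuffingHill.quarterPeriod δ,
    DuffingHill.isLeast_period_duffing_sq hδ, ⟨DuffingHill.isHillSolution_duffing δ, fun h => ?_,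
      DuffingHill.duffing_antiperiodic δ⟩, DuffingHill.isHillSolution_jacobiSn δ, fun h => ?_,
    DuffingHill.jacobiSn_antiperiodic δ⟩⟩
  · rw [hU]
    ext x
    exact ⟨fun h => ⟨h.1, one_pos.trans h.2.1, h.2⟩, fun h => ⟨h.1, h.2.2⟩⟩
  · rw [hU]
    exact DuffingHill.frontier_tongue
  · have h0 := (DuffingHill.isDuffingSolution_duffing δ).init
    rw [h] at h0
    exact hδ.ne h0
  · have h1 := DuffingHill.jacobiSn_quarterPeriod δ
    have h0 := congrFun h (DuffingHill.quarterPeriod δ)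
    simp only [h1] at h0
    exact one_ne_zero h0
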